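/- Let $\mathbb K$ be a field of characteristic zero and $q$ an indeterminate. Let $U=U_q(\mathfrak{sl}_2)$ be the $\mathbb K(q)$-algebra with generators $E_1,F_1,K_1^{\pm1}$ and relations $K_1K_1^{-1}=K_1^{-1}K_1=1$, $K_1E_1K_1^{-1}=q^2E_1$, $K_1F_1K_1^{-1}=q^{-2}F_1$, $E_1F_1-F_1E_1=\frac{K_1-K_1^{-1}}{q-q^{-1}}$. Let $\overline{\,\cdot\,}^U$ be the $\mathbb K$-algebra automorphism of $U$ with $q\mapsto q^{-1}$, $E_1\mapsto E_1$, $F_1\mapsto F_1$, $K_1\mapsto K_1^{-1}$. Let $U^+$ be the subalgebra generated by $E_1$, and let $U^+_{m\alpha_1}=\{u\in U^+ : K_1uK_1^{-1}=q^{2m}u\}$ for $m\in\mathbb N_0$. Let $\mathscr U$ be the algebra of natural endomorphisms of the forgetful functor from finite-dimensional $U$-modules of type $1$ (those that are the direct sum of the eigenspaces of $K_1$ for the eigenvalues $q^n$, $n\in\mathbb Z$) to $\mathbb K(q)$-vector spaces. Elements of $U$ and of $\prod_{m\ge 0}U^+_{m\alpha_1}$ are viewed in $\mathscr U$ through their action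 on such modules. Let $c_1\in\mathbb K(q)$ with $c_1\neq 0$ and $c_1=q^{-2}\,\overline{c_1}$, where $\overline{c_1}$ is the image of $c_1$ under $q\mapsto q^{-1}$. For the Satake diagram of type $AI_1$ (one white node) with parameters $\mathbf c=(c_1)$ and $\mathbf s=(0)$, the quantum symmetric pair coideal subalgebra $B_{\mathbf c,\mathbf 0}\subset U$ is the subalgebra generated by $B_1=F_1-c_1E_1K_1^{-1}$. Let $\overline{\,\cdot\,}^B$ be the $\mathbb K$-algebra automorphism of $B_{\mathbf c,\mathbf 0}$ with $q\mapsto q^{-1}$ and $B_1\mapsto B_1$. The quasi $K$-matrix is the element $\mathfrak X=\sum_{m\ge0}\mathfrak X_{m}$ with $\mathfrak X_m\in U^+_{m\alpha_1}$, $\mathfrak X_0=1$ and $$\overline{b}^B\,\mathfrak X=\mathfrak X\,\overline{b}^U\qquad\text{in }\mathscr U\text{ for all }b\in B_{\mathbf c,\mathbf 0}.$$ Then there is exactly one such element, and it is given by $$\mathfrak X=\sum_{n\ge 0}\frac{(q-q^{-1})^n}{\{2n\}!!}\,(q^2c_1)^n\,E_1^{2n},$$ where $\{m\}=1+q^2+\dots+q^{2(m-1)}$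 for $m\ge 1$, $\{2n\}!!=\prod_{k=0}^{n-1}\{2n-2k\}$ and $\{0\}!!=1$. -/

import Mathlib

/-!
The rank one Satake diagram `AI₁`: one white node, so `I = {1}`, `X = ∅`, `τ = id`, and the Lie
algebra is `sl₂`.  The base field of the quantised enveloping algebra is `k(q)`, with `q` an
indeterminate.
-/

noncomputable section

namespace AI1

universe u

/-! ### Root data -/

/-- The bilinear form on the root lattice `Q = ℤ α₁ ≅ ℤ`, normalised by `(α₁, α₁) = 2`. -/
def form (m n : ℤ) : ℤ := 2 * m * n

/-- `Θ = - w_X ∘ τ` on the root lattice; here `w_X = 1` and `τ = id`. -/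
def Theta (m : ℤ) : ℤ := -m

/-! ### The field `k(q)`, its bar involution and `q`-numbers -/

section Field

variable (k : Type u) [Field k]

/-- The indeterminate `q` of `k(q)`. -/
def q : RatFunc k := RatFunc.X

lemma q_ne_zero : q k ≠ 0 := RatFunc.X_ne_zero

lemma q_zpow_injective : Function.Injective (fun n : ℤ => (q k) ^ n) := by
  have hnat : ∀ n : ℕ, ((q k) ^ n).intDegree = n := by
    intro n
    induction n with
    | zero => simp
    | succ n ih =>
      rw [pow_succ, RatFunc.intDegree_mul (pow_ne_zero _ (q_ne_zero k)) (q_ne_zero k), ih]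
      simp [q]
  have hint : ∀ n : ℤ, ((q k) ^ n).intDegree = n := by
    intro n
    obtain ⟨m, rfl | rfl⟩ := n.eq_nat_or_neg
    · simpa using hnat m
    · rw [zpow_neg, RatFunc.intDegree_inv, zpow_natCast, hnat]
  intro a b h
  have := congrArg RatFunc.intDegree h
  simpa [hint] using this

lemma transcendental_q_inv : Transcendental k (q k)⁻¹ := by
  intro h
  rw [IsAlgebraic.inv_iff] at h
  exact RatFunc.transcendental_X h

/-- The `k`-algebra endomorphism of `k(q)` with `q ↦ q⁻¹`. -/
def barHom : RatFunc k →ₐ[k] RatFunc k :=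
  RatFunc.liftAlgHom (Polynomial.aeval (q k)⁻¹) (by
    intro p hp
    rw [Submonoid.mem_comap, mem_nonZeroDivisors_iff_ne_zero]
    rw [mem_nonZeroDivisors_iff_ne_zero] at hp
    intro h0
    exact hp ((transcendental_iff.mp (transcendental_q_inv k)) p h0))

lemma barHom_algebraMap (p : Polynomial k) :
    barHom k (algebraMap _ _ p) = Polynomial.aeval (q k)⁻¹ p := by
  have := RatFunc.liftAlgHom_apply_div (S := k) (L := RatFunc k) (Polynomial.aeval (q k)⁻¹)
    (by
      intro p hp
      rw [Submonoid.mem_comap, mem_nonZeroDivisors_iff_ne_zero]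
      rw [mem_nonZeroDivisors_iff_ne_zero] at hp
      intro h0
      exact hp ((transcendental_iff.mp (transcendental_q_inv k)) p h0)) p 1
  simpa [barHom] using this

lemma barHom_q : barHom k (q k) = (q k)⁻¹ := by
  have := barHom_algebraMap k Polynomial.X
  simpa [q, RatFunc.algebraMap_X] using this

lemma barHom_barHom (x : RatFunc k) : barHom k (barHom k x) = x := by
  have key : (barHom k).comp (barHom k) = AlgHom.id k (RatFunc k) := by
    apply IsLocalization.algHom_ext (W := nonZeroDivisors (Polynomial k)) (A := Polynomial k)
    apply Polynomial.algHom_ext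
    simp only [AlgHom.comp_apply]
    have h1 : (Algebra.algHom k (Polynomial k) (RatFunc k)) Polynomial.X = q k := by
      exact RatFunc.algebraMap_X
    simp [h1, barHom_q]
  exact DFunLike.congr_fun key x

/-- The bar involution of `k(q)`: the `k`-algebra automorphism with `q ↦ q⁻¹`. -/
def bar : RatFunc k ≃ₐ[k] RatFunc k :=
  AlgEquiv.ofAlgHom (barHom k) (barHom k) (AlgHom.ext (barHom_barHom k))
    (AlgHom.ext (barHom_barHom k))

lemma bar_q : bar k (q k) = (q k)⁻¹ := barHom_q k

lemma bar_bar (x : RatFunc k) : bar k (bar k x) = x := barHom_barHom k x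

/-- `[n] = (qⁿ - q⁻ⁿ) / (q - q⁻¹)`. -/
def qNum (n : ℤ) : RatFunc k := ((q k) ^ n - (q k) ^ (-n)) / (q k - (q k)⁻¹)

/-- `{n} = q^{n-1} [n]`, which is `1 + q² + ⋯ + q^{2(n-1)}`. -/
def brace (n : ℕ) : RatFunc k := (q k) ^ ((n : ℤ) - 1) * qNum k n

/-- `{n}!! = ∏_{j=0}^{⌈n/2⌉-1} {n - 2j}`, with `{0}!! = 1`. -/
def braceDoubleFactorial (n : ℕ) : RatFunc k :=
  ∏ j ∈ Finset.range ((n + 1) / 2), brace k (n - 2 * j)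

end Field

/-! ### The quantised enveloping algebra `U_q(sl₂)` -/

/-- Generators `E₁, F₁, K₁, K₁⁻¹`. -/
inductive Gen : Type
  | E | F | K | Kinv

section Algebra

variable (k : Type u) [Field k]

/-- A generator as an element of the free algebra. -/
abbrev gen (x : Gen) : FreeAlgebra (RatFunc k) Gen := FreeAlgebra.ι (RatFunc k) x

/-- The defining relations of `U_q(sl₂)`. -/
inductive Rel : FreeAlgebra (RatFunc k) Gen → FreeAlgebra (RatFunc k) Gen → Prop
  | K_Kinv : Rel (gen k .K * gen k .Kinv) 1
  | Kinv_K : Rel (gen k .Kinv * gen k .K) 1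
  | K_E : Rel (gen k .K * gen k .E * gen k .Kinv) ((q k) ^ (2 : ℤ) • gen k .E)
  | K_F : Rel (gen k .K * gen k .F * gen k .Kinv) ((q k) ^ (-2 : ℤ) • gen k .F)
  | E_F : Rel (gen k .E * gen k .F - gen k .F * gen k .E)
      ((q k - (q k)⁻¹)⁻¹ • (gen k .K - gen k .Kinv))

/-- The quantised enveloping algebra `U = U_q(sl₂)` over `k(q)`. -/
def U : Type u := RingQuot (Rel k)

instance : Ring (U k) := inferInstanceAs (Ring (RingQuot (Rel k)))

instance : Algebra (RatFunc k) (U k) :=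
  inferInstanceAs (Algebra (RatFunc k) (RingQuot (Rel k)))

/-- The quotient map from the free algebra. -/
def mkU : FreeAlgebra (RatFunc k) Gen →ₐ[RatFunc k] U k :=
  RingQuot.mkAlgHom (RatFunc k) (Rel k)

variable {k} in
lemma mkU_rel {x y : FreeAlgebra (RatFunc k) Gen} (h : Rel k x y) : mkU k x = mkU k y :=
  RingQuot.mkAlgHom_rel (RatFunc k) h

/-- The class of a generator in `U`. -/
def ofGen (x : Gen) : U k := mkU k (gen k x)

/-- `E₁` -/
def E : U k := ofGen k .E

/-- `F₁` -/
def F : U k := ofGen k .F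

/-- `K₁`, an invertible element of `U`. -/
def K : (U k)ˣ where
  val := ofGen k .K
  inv := ofGen k .Kinv
  val_inv := by
    simpa [ofGen] using mkU_rel (Rel.K_Kinv (k := k))
  inv_val := by
    simpa [ofGen] using mkU_rel (Rel.Kinv_K (k := k))

/-- `K_λ = K₁ⁿ` for `λ = n α₁` in the root lattice. -/
def Klam (n : ℤ) : U k := ((K k ^ n : (U k)ˣ) : U k)

variable {k} in
/-- Algebra homomorphisms out of `U`, from images of the generators satisfying the relations. -/
def liftU {A : Type*} [Ring A] [Algebra (RatFunc k) A] (e f t t' : A)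
    (h1 : t * t' = 1) (h2 : t' * t = 1)
    (h3 : t * e * t' = (q k) ^ (2 : ℤ) • e) (h4 : t * f * t' = (q k) ^ (-2 : ℤ) • f)
    (h5 : e * f - f * e = (q k - (q k)⁻¹)⁻¹ • (t - t')) : U k →ₐ[RatFunc k] A :=
  RingQuot.liftAlgHom (RatFunc k)
    ⟨FreeAlgebra.lift (RatFunc k) (fun x => match x with
      | .E => e | .F => f | .K => t | .Kinv => t'), by
      intro x y hxy
      cases hxy <;> simpa⟩

variable {k} in
lemma liftU_ofGen {A : Type*} [Ring A] [Algebra (RatFunc k) A] (e f t t' : A)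
    (h1 : t * t' = 1) (h2 : t' * t = 1)
    (h3 : t * e * t' = (q k) ^ (2 : ℤ) • e) (h4 : t * f * t' = (q k) ^ (-2 : ℤ) • f)
    (h5 : e * f - f * e = (q k - (q k)⁻¹)⁻¹ • (t - t')) (x : Gen) :
    liftU e f t t' h1 h2 h3 h4 h5 (ofGen k x) = (match x with
      | .E => e | .F => f | .K => t | .Kinv => t') := by
  refine (RingQuot.liftAlgHom_mkAlgHom_apply (RatFunc k) _ _ _).trans ?_
  exact FreeAlgebra.lift_ι_apply _ _

section liftU

variable {k}
variable {A : Type*} [Ring A] [Algebra (RatFunc k) A] {e f t t' : A}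
    {h1 : t * t' = 1} {h2 : t' * t = 1}
    {h3 : t * e * t' = (q k) ^ (2 : ℤ) • e} {h4 : t * f * t' = (q k) ^ (-2 : ℤ) • f}
    {h5 : e * f - f * e = (q k - (q k)⁻¹)⁻¹ • (t - t')}

@[simp] lemma liftU_E : liftU e f t t' h1 h2 h3 h4 h5 (E k) = e :=
  liftU_ofGen _ _ _ _ _ _ _ _ _ .E

@[simp] lemma liftU_F : liftU e f t t' h1 h2 h3 h4 h5 (F k) = f :=
  liftU_ofGen _ _ _ _ _ _ _ _ _ .F

@[simp] lemma liftU_K : liftU e f t t' h1 h2 h3 h4 h5 (K k : U k) = t :=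
  liftU_ofGen _ _ _ _ _ _ _ _ _ .K

@[simp] lemma liftU_Kinv : liftU e f t t' h1 h2 h3 h4 h5 ((K k)⁻¹ : (U k)ˣ) = t' :=
  liftU_ofGen _ _ _ _ _ _ _ _ _ .Kinv

end liftU

lemma K_mul_E : (K k : U k) * E k * ((K k)⁻¹ : (U k)ˣ) = (q k) ^ (2 : ℤ) • E k := by
  have h := mkU_rel (Rel.K_E (k := k))
  simp only [map_mul, map_smul] at h
  exact h

lemma K_mul_F : (K k : U k) * F k * ((K k)⁻¹ : (U k)ˣ) = (q k) ^ (-2 : ℤ) • F k := by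
  have h := mkU_rel (Rel.K_F (k := k))
  simp only [map_mul, map_smul] at h
  exact h

lemma E_mul_F : E k * F k - F k * E k =
    (q k - (q k)⁻¹)⁻¹ • ((K k : U k) - ((K k)⁻¹ : (U k)ˣ)) := by
  have h := mkU_rel (Rel.E_F (k := k))
  simp only [map_mul, map_sub, map_smul] at h
  exact h

/-! ### The bar involution of `U` -/

/-- The ring `U` with scalars acting through the bar involution of `k(q)`; this makes semilinear
ring endomorphisms of `U` into algebra homomorphisms `U → UBar`. -/
def UBar : Type u := U k

instance : Ring (UBar k) := inferInstanceAs (Ring (U k))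

instance : Algebra (RatFunc k) (UBar k) :=
  RingHom.toAlgebra' (((algebraMap (RatFunc k) (U k)).comp (bar k : RatFunc k →+* RatFunc k)) :
    RatFunc k →+* U k) (fun c x => Algebra.commutes (R := RatFunc k) (A := U k) (bar k c) x)

lemma bar_q_sub : bar k (q k - (q k)⁻¹)⁻¹ = -(q k - (q k)⁻¹)⁻¹ := by
  rw [map_inv₀, map_sub, map_inv₀, bar_q, inv_inv, ← neg_sub, inv_neg]

lemma Kinv_mul_E : ((K k)⁻¹ : (U k)ˣ) * E k * (K k : U k) = (q k) ^ (-2 : ℤ) • E k := by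
  have h := congrArg (fun x => ((K k)⁻¹ : (U k)ˣ) * ((q k) ^ (-2 : ℤ) • x) * (K k : U k))
    (K_mul_E k)
  simp only [smul_smul, ← zpow_add₀ (q_ne_zero k), mul_smul_comm, smul_mul_assoc, mul_assoc,
    Units.inv_mul, mul_one, Units.inv_mul_cancel_left] at h
  rw [h, mul_assoc]
  norm_num

lemma Kinv_mul_F : ((K k)⁻¹ : (U k)ˣ) * F k * (K k : U k) = (q k) ^ (2 : ℤ) • F k := by
  have h := congrArg (fun x => ((K k)⁻¹ : (U k)ˣ) * ((q k) ^ (2 : ℤ) • x) * (K k : U k))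
    (K_mul_F k)
  simp only [smul_smul, ← zpow_add₀ (q_ne_zero k), mul_smul_comm, smul_mul_assoc, mul_assoc,
    Units.inv_mul, mul_one, Units.inv_mul_cancel_left] at h
  rw [h, mul_assoc]
  norm_num

/-- The identity `U → UBar`, as a ring isomorphism. -/
def toBar : U k ≃+* UBar k := RingEquiv.refl (U k)

lemma toBar_smul (c : RatFunc k) (x : U k) : c • toBar k x = toBar k (bar k c • x) := by
  rw [Algebra.smul_def (R := RatFunc k) (A := U k)]
  exact Algebra.smul_def (R := RatFunc k) (A := UBar k) c (toBar k x)

/-- The bar involution of `U` as an algebra homomorphism to `UBar`. -/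
def barUAux : U k →ₐ[RatFunc k] UBar k :=
  liftU (toBar k (E k)) (toBar k (F k)) (toBar k ((K k)⁻¹ : (U k)ˣ)) (toBar k (K k : U k))
    (by rw [← map_mul, Units.inv_mul, map_one])
    (by rw [← map_mul, Units.mul_inv, map_one])
    (by
      rw [toBar_smul, map_zpow₀, bar_q, inv_zpow, ← zpow_neg, ← map_mul, ← map_mul, Kinv_mul_E])
    (by
      rw [toBar_smul, map_zpow₀, bar_q, inv_zpow, ← zpow_neg, ← map_mul, ← map_mul, Kinv_mul_F,
        neg_neg])
    (by
      rw [← map_sub, toBar_smul, bar_q_sub, ← map_mul, ← map_mul, ← map_sub, E_mul_F]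
      rw [neg_smul, ← smul_neg, neg_sub])

/-- The bar involution of `U` as a ring endomorphism. -/
def barUHom : U k →+* U k := ((toBar k).symm : UBar k →+* U k).comp (barUAux k : U k →+* UBar k)

lemma barUHom_E : barUHom k (E k) = E k := by
  simp [barUHom, barUAux]

lemma barUHom_F : barUHom k (F k) = F k := by
  simp [barUHom, barUAux]

lemma barUHom_K : barUHom k (K k : U k) = ((K k)⁻¹ : (U k)ˣ) := by
  simp [barUHom, barUAux]

lemma barUHom_Kinv : barUHom k ((K k)⁻¹ : (U k)ˣ) = (K k : U k) := by
  simp [barUHom, barUAux]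

lemma barUHom_algebraMap (c : RatFunc k) :
    barUHom k (algebraMap _ _ c) = algebraMap (RatFunc k) (U k) (bar k c) := by
  have h : barUAux k (algebraMap _ _ c) = algebraMap (RatFunc k) (UBar k) c :=
    AlgHom.commutes _ c
  simp only [barUHom, RingHom.comp_apply, RingHom.coe_coe]
  rw [h]
  rfl

lemma algHom_ext_U {A : Type*} [Ring A] [Algebra (RatFunc k) A] (f g : U k →ₐ[RatFunc k] A)
    (hE : f (E k) = g (E k)) (hF : f (F k) = g (F k)) (hK : f (K k : U k) = g (K k : U k))
    (hK' : f ((K k)⁻¹ : (U k)ˣ) = g ((K k)⁻¹ : (U k)ˣ)) : f = g := by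
  apply RingQuot.ringQuot_ext'
  apply FreeAlgebra.hom_ext
  funext x
  cases x
  exacts [hE, hF, hK, hK']

lemma barUHom_barUHom (x : U k) : barUHom k (barUHom k x) = x := by
  let f : U k →ₐ[RatFunc k] U k :=
    { (barUHom k).comp (barUHom k) with
      commutes' := fun c => by
        change barUHom k (barUHom k _) = _
        rw [barUHom_algebraMap, barUHom_algebraMap, bar_bar] }
  have hf : ∀ y, f y = barUHom k (barUHom k y) := fun _ => rfl
  have : f = AlgHom.id _ _ := by
    apply algHom_ext_U <;>
      simp only [hf, barUHom_E, barUHom_F, barUHom_K, barUHom_Kinv, AlgHom.id_apply]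
  rw [← hf, this]
  rfl

/-- The bar involution of `U`: the `k`-algebra automorphism with
`q ↦ q⁻¹`, `E₁ ↦ E₁`, `F₁ ↦ F₁`, `K₁ ↦ K₁⁻¹`. -/
def barU : U k ≃+* U k :=
  RingEquiv.ofRingHom (barUHom k) (barUHom k) (RingHom.ext (barUHom_barUHom k))
    (RingHom.ext (barUHom_barUHom k))

lemma barU_E : barU k (E k) = E k := barUHom_E k

lemma barU_F : barU k (F k) = F k := barUHom_F k

lemma barU_K : barU k (K k : U k) = ((K k)⁻¹ : (U k)ˣ) := barUHom_K k

lemma barU_algebraMap (c : RatFunc k) :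
    barU k (algebraMap _ _ c) = algebraMap (RatFunc k) (U k) (bar k c) := barUHom_algebraMap k c

/-! ### The positive part and its completion -/

/-- `U⁺`, the subalgebra generated by `E₁`. -/
def UPlus : Subalgebra (RatFunc k) (U k) := Algebra.adjoin (RatFunc k) {E k}

/-- The weight space `U⁺_μ` for `μ = m α₁`: the elements `u` of `U⁺` on which `K₁` acts by
`q^{(μ, α₁)}` in the left adjoint action, `ad(K₁)(u) = K₁ u K₁⁻¹`. -/
def UPlusWt (m : ℕ) : Submodule (RatFunc k) (U k) where
  carrier := {u | u ∈ UPlus k ∧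
    (K k : U k) * u * ((K k)⁻¹ : (U k)ˣ) = (q k) ^ form m 1 • u}
  add_mem' := by
    rintro a b ⟨ha, ha'⟩ ⟨hb, hb'⟩
    exact ⟨add_mem ha hb, by rw [mul_add, add_mul, ha', hb', smul_add]⟩
  zero_mem' := ⟨zero_mem _, by simp⟩
  smul_mem' := by
    rintro c a ⟨ha, ha'⟩
    exact ⟨Subalgebra.smul_mem _ ha c, by
      rw [mul_smul_comm, smul_mul_assoc, ha', smul_comm]⟩

/-- The completion `∏_{μ ∈ Q⁺} U⁺_μ` of `U⁺`, where `Q⁺ = ℕ α₁`.  Its elements are the formal sums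
`∑_μ u_μ` with `u_μ ∈ U⁺_μ`. -/
abbrev UPlusHat : Type u := (m : ℕ) → UPlusWt k m

/-! ### The completion `𝒰` of `U` -/

/-- Finite-dimensional `U`-modules of type 1: finite-dimensional vector spaces over `k(q)` with a
`U`-action for which they are the direct sum of the weight spaces on which `K₁` acts by `qⁿ`,
`n ∈ ℤ`. -/
structure OInt where
  carrier : Type u
  [addCommGroup : AddCommGroup carrier]
  [module : Module (RatFunc k) carrier]
  [finite : FiniteDimensional (RatFunc k) carrier]
  ρ : U k →ₐ[RatFunc k] Module.End (RatFunc k) carrier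
  type_one : ⨆ n : ℤ, Module.End.eigenspace (ρ (K k : U k)) ((q k) ^ n) = ⊤

attribute [instance] OInt.addCommGroup OInt.module OInt.finite

variable {k}

/-- A linear map between two modules that commutes with the action of `U`. -/
def IsModuleHom (V W : OInt k) (f : V.carrier →ₗ[RatFunc k] W.carrier) : Prop :=
  ∀ u : U k, f ∘ₗ V.ρ u = W.ρ u ∘ₗ f

variable (k) in
/-- `𝒰 = End(For)`: the algebra of natural transformations from the forgetful functor
(finite-dimensional `U`-modules of type 1 to vector spaces) to itself. -/
def UCompl : Subalgebra (RatFunc k)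
    ((V : OInt k) → Module.End (RatFunc k) V.carrier) where
  carrier := {φ | ∀ (V W : OInt k) (f : V.carrier →ₗ[RatFunc k] W.carrier), IsModuleHom V W f →
    f ∘ₗ φ V = φ W ∘ₗ f}
  mul_mem' := by
    intro a b ha hb V W f hf
    simp only [Pi.mul_apply, Module.End.mul_eq_comp]
    rw [← LinearMap.comp_assoc, ha V W f hf, LinearMap.comp_assoc, hb V W f hf,
      LinearMap.comp_assoc]
  add_mem' := by
    intro a b ha hb V W f hf
    simp only [Pi.add_apply]
    rw [LinearMap.comp_add, LinearMap.add_comp, ha V W f hf, hb V W f hf]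
  algebraMap_mem' := by
    intro c V W f _
    ext v
    simp [Module.algebraMap_end_apply]

variable (k) in
/-- The canonical map `U → 𝒰`, `u ↦` (action of `u` on `V`)`_V`. -/
def toCompl : U k →ₐ[RatFunc k] UCompl k :=
  (AlgHom.pi (fun V : OInt k => V.ρ)).codRestrict (UCompl k)
    (fun u _ _ _ hf => hf u)

/-- Only finitely many components of an element of the completion of `U⁺` act non-trivially on a
given module. -/
lemma finite_support_act (Ξ : UPlusHat k) (V : OInt k) :
    (Function.support fun m => V.ρ (Ξ m : U k)).Finite := by
  set T := V.ρ (K k : U k) with hT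
  have hfin : {n : ℤ | Module.End.HasEigenvalue T ((q k) ^ n)}.Finite :=
    (Module.End.finite_hasEigenvalue T).preimage (q_zpow_injective k).injOn
  obtain ⟨N, hN⟩ : ∃ N : ℕ, ∀ n : ℤ, Module.End.HasEigenvalue T ((q k) ^ n) → |n| ≤ N := by
    obtain ⟨B, hB⟩ := (hfin.image (fun n : ℤ => |n|)).bddAbove
    refine ⟨B.toNat, fun n hn => ?_⟩
    have := hB ⟨n, hn, rfl⟩
    simp only at this
    omega
  apply (Set.finite_Iic N).subset
  intro m hm
  by_contra hlt
  apply hm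
  simp only [Set.mem_Iic, not_le] at hlt
  have hcomm : T * V.ρ (Ξ m : U k) = (q k) ^ form m 1 • (V.ρ (Ξ m : U k) * T) := by
    have h := congrArg (· * (K k : U k)) (Ξ m).2.2
    simp only [mul_assoc, Units.inv_mul, mul_one, smul_mul_assoc] at h
    have h2 := congrArg V.ρ h
    simpa only [map_mul, map_smul] using h2
  have hle : (⊤ : Submodule (RatFunc k) V.carrier) ≤ LinearMap.ker (V.ρ (Ξ m : U k)) := by
    rw [← V.type_one]
    apply iSup_le
    intro n v hv
    rw [Module.End.mem_eigenspace_iff] at hv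
    rw [LinearMap.mem_ker]
    by_contra hne
    have hv0 : v ≠ 0 := by
      rintro rfl
      simp at hne
    have h1 : Module.End.HasEigenvalue T ((q k) ^ n) :=
      Module.End.hasEigenvalue_of_hasEigenvector
        (Module.End.hasEigenvector_iff.mpr ⟨Module.End.mem_eigenspace_iff.mpr hv, hv0⟩)
    have h2 : Module.End.HasEigenvalue T ((q k) ^ (form m 1 + n)) := by
      refine Module.End.hasEigenvalue_of_hasEigenvector
        (Module.End.hasEigenvector_iff.mpr ⟨Module.End.mem_eigenspace_iff.mpr ?_, hne⟩)
      have h := LinearMap.congr_fun hcomm v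
      simp only [Module.End.mul_apply, LinearMap.smul_apply] at h
      rw [h, hT, hv, map_smul, smul_smul, zpow_add₀ (q_ne_zero k)]
    have b1 := abs_le.mp (hN _ h1)
    have b2 := abs_le.mp (hN _ h2)
    simp only [form] at b2
    omega
  exact LinearMap.ker_eq_top.mp (top_le_iff.mp hle)

/-- The canonical map from the completion of `U⁺` to `𝒰`: the formal sum `∑_μ u_μ` acts on each
module by the sum of the actions of its components, all but finitely many of which vanish. -/
def hatToCompl (Ξ : UPlusHat k) : UCompl k :=
  ⟨fun V => ∑ᶠ m : ℕ, V.ρ (Ξ m : U k), by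
    intro V W f hf
    have hV := finite_support_act Ξ V
    have hW := finite_support_act Ξ W
    beta_reduce
    rw [finsum_eq_sum_of_support_subset (s := (hV.union hW).toFinset) _
        (by simp), finsum_eq_sum_of_support_subset (s := (hV.union hW).toFinset) _ (by simp)]
    ext v
    simp only [LinearMap.comp_apply, LinearMap.sum_apply, map_sum]
    refine Finset.sum_congr rfl fun m _ => ?_
    exact LinearMap.congr_fun (hf (Ξ m : U k)) v⟩

/-! ### The quantum symmetric pair coideal subalgebra -/

/-- `B₁ = F₁ - c₁ E₁ K₁⁻¹ + s₁ K₁⁻¹` (here `s(τ(1)) = 1` and `T_{w_X} = id`). -/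
def B (c s : RatFunc k) : U k :=
  F k - c • (E k * ((K k)⁻¹ : (U k)ˣ)) + s • (((K k)⁻¹ : (U k)ˣ) : U k)

/-- The subalgebra `B_{c,s}` of `U` generated by `K_λ` for `λ ∈ Q` with `Θ(λ) = λ` and by `B₁`
(the algebra `M_X` is trivial, because `X = ∅`). -/
def Bcs (c s : RatFunc k) : Subalgebra (RatFunc k) (U k) :=
  Algebra.adjoin (RatFunc k) ({x | ∃ n : ℤ, Theta n = n ∧ x = Klam k n} ∪ {B c s})

lemma B_mem (c s : RatFunc k) : B c s ∈ Bcs c s :=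
  Algebra.subset_adjoin (Or.inr rfl)

lemma Bcs_eq_range (c s : RatFunc k) :
    Bcs c s = (Polynomial.aeval (R := RatFunc k) (B c s)).range := by
  rw [← Algebra.adjoin_singleton_eq_range_aeval]
  apply le_antisymm
  · apply Algebra.adjoin_le
    rintro x (⟨n, hn, rfl⟩ | rfl)
    · obtain rfl : n = 0 := by
        unfold Theta at hn
        omega
      simp [Klam]
    · exact Algebra.self_mem_adjoin_singleton _ _
  · exact Algebra.adjoin_mono (by simp)

lemma q_sub_ne_zero : q k - (q k)⁻¹ ≠ 0 := by
  intro h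
  have h1 : (q k) ^ (1 : ℤ) = (q k) ^ (-1 : ℤ) := by
    simpa [sub_eq_zero] using h
  exact absurd (q_zpow_injective k h1) (by norm_num)

lemma q_pow_mul_inv_pow (n : ℕ) : (q k) ^ n * ((q k)⁻¹) ^ n = 1 := by
  rw [← mul_pow, mul_inv_cancel₀ (q_ne_zero k), one_pow]

variable (k) in
/-- Action of `E₁` in `verma`. -/
def vermaE : Module.End (RatFunc k) (ℕ → RatFunc k) where
  toFun := fun f m => -(((q k) ^ (m + 1) - ((q k)⁻¹) ^ (m + 1)) *
    ((q k) ^ m - ((q k)⁻¹) ^ m)) * ((q k - (q k)⁻¹)⁻¹) ^ 2 * f (m + 1)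
  map_add' := fun f g => by
    funext m
    simp only [Pi.add_apply]
    ring
  map_smul' := fun a f => by
    funext m
    simp only [Pi.smul_apply, smul_eq_mul, RingHom.id_apply]
    ring

variable (k) in
/-- Action of `F₁` in `verma`. -/
def vermaF : Module.End (RatFunc k) (ℕ → RatFunc k) where
  toFun := fun f m => if m = 0 then 0 else f (m - 1)
  map_add' := fun f g => by
    funext m
    by_cases h : m = 0 <;> simp [h]
  map_smul' := fun a f => by
    funext m
    by_cases h : m = 0 <;> simp [h]

/-- The diagonal operator `f ↦ (m ↦ x^{2m} f(m))`. -/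
def vermaDiag (x : RatFunc k) : Module.End (RatFunc k) (ℕ → RatFunc k) where
  toFun := fun f m => x ^ (2 * m) * f m
  map_add' := fun f g => by
    funext m
    simp only [Pi.add_apply]
    ring
  map_smul' := fun a f => by
    funext m
    simp only [Pi.smul_apply, smul_eq_mul, RingHom.id_apply]
    ring

variable (k) in
/-- A representation of `U` on functions `ℕ → k(q)` (a completed Verma module), used to see that
`B₁` is transcendental over `k(q)`. -/
def verma : U k →ₐ[RatFunc k] Module.End (RatFunc k) (ℕ → RatFunc k) :=
  liftU (vermaE k) (vermaF k) (vermaDiag (q k)⁻¹) (vermaDiag (q k))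
    (by
      ext1 f
      funext m
      simp only [Module.End.mul_apply, vermaDiag, LinearMap.coe_mk, AddHom.coe_mk,
        Module.End.one_apply]
      linear_combination f m * q_pow_mul_inv_pow (k := k) (2 * m))
    (by
      ext1 f
      funext m
      simp only [Module.End.mul_apply, vermaDiag, LinearMap.coe_mk, AddHom.coe_mk,
        Module.End.one_apply]
      linear_combination f m * q_pow_mul_inv_pow (k := k) (2 * m))
    (by
      ext1 f
      funext m
      have h := q_pow_mul_inv_pow (k := k) (2 * m)
      simp only [Module.End.mul_apply, vermaDiag, vermaE, LinearMap.coe_mk, AddHom.coe_mk,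
        LinearMap.smul_apply, Pi.smul_apply, smul_eq_mul, zpow_ofNat]
      rw [show 2 * (m + 1) = 2 * m + 2 by ring, pow_add (q k) (2 * m) 2]
      generalize -((q k ^ (m + 1) - (q k)⁻¹ ^ (m + 1)) * (q k ^ m - (q k)⁻¹ ^ m)) *
        (q k - (q k)⁻¹)⁻¹ ^ 2 = e
      linear_combination q k ^ 2 * e * f (m + 1) * h)
    (by
      ext1 f
      funext m
      rcases m with _ | m
      · simp [vermaDiag, vermaF]
      · have h := q_pow_mul_inv_pow (k := k) (2 * m)
        simp only [Module.End.mul_apply, vermaDiag, vermaF, LinearMap.coe_mk, AddHom.coe_mk,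
          LinearMap.smul_apply, Pi.smul_apply, smul_eq_mul, Nat.add_eq_zero_iff, one_ne_zero,
          and_false, if_false, Nat.add_sub_cancel, zpow_neg, zpow_ofNat, ← inv_pow]
        rw [show 2 * (m + 1) = 2 * m + 2 by ring, pow_add (q k)⁻¹ (2 * m) 2]
        linear_combination (q k)⁻¹ ^ 2 * f m * h)
    (by
      ext1 f
      funext m
      rcases m with _ | m
      · simp [vermaDiag, vermaF, vermaE]
      · simp only [Module.End.mul_apply, vermaDiag, vermaE, vermaF, LinearMap.coe_mk,
          AddHom.coe_mk, LinearMap.smul_apply, LinearMap.sub_apply, Pi.sub_apply,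
          Pi.smul_apply, smul_eq_mul, Nat.add_eq_zero_iff, one_ne_zero,
          and_false, if_false, Nat.add_sub_cancel]
        have hd : (q k - (q k)⁻¹) * (q k - (q k)⁻¹)⁻¹ = 1 := mul_inv_cancel₀ q_sub_ne_zero
        have hp : q k * (q k)⁻¹ = 1 := mul_inv_cancel₀ (q_ne_zero k)
        obtain ⟨a, ha⟩ : ∃ a, a = q k ^ (m + 1) := ⟨_, rfl⟩
        obtain ⟨b, hb⟩ : ∃ b, b = (q k)⁻¹ ^ (m + 1) := ⟨_, rfl⟩
        have h1 : q k ^ m = (q k)⁻¹ * a := by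
          rw [ha, pow_succ]
          linear_combination -q k ^ m * hp
        have h2 : (q k)⁻¹ ^ m = q k * b := by
          rw [hb, pow_succ]
          linear_combination -(q k)⁻¹ ^ m * hp
        rw [pow_succ (q k) (m + 1), pow_succ (q k)⁻¹ (m + 1), mul_comm 2 (m + 1), pow_mul, pow_mul,
          ← ha, ← hb, h1, h2]
        linear_combination (b ^ 2 - a ^ 2) * (q k - (q k)⁻¹)⁻¹ * f (m + 1) * hd)

lemma verma_B_apply (c s : RatFunc k) (f : ℕ → RatFunc k) (n : ℕ) (hf : ∀ m, n < m → f m = 0) :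
    verma k (B c s) f (n + 1) = f n ∧ ∀ m, n + 1 < m → verma k (B c s) f m = 0 := by
  have hB : verma k (B c s) =
      vermaF k - c • (vermaE k * vermaDiag (q k)) + s • vermaDiag (q k) := by
    simp [B, verma]
  constructor
  · simp [hB, vermaF, vermaE, vermaDiag, hf (n + 1) (by omega), hf (n + 2) (by omega)]
  · intro m hm
    simp [hB, vermaF, vermaE, vermaDiag, hf m (by omega), hf (m + 1) (by omega),
      hf (m - 1) (by omega)]

/-- `B₁` is transcendental over `k(q)`. -/
lemma aeval_B_injective (c s : RatFunc k) :
    Function.Injective (Polynomial.aeval (R := RatFunc k) (B c s)) := by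
  set v : ℕ → RatFunc k := Pi.single 0 1 with hv
  have key : ∀ n, (verma k (B c s ^ n)) v n = 1 ∧ ∀ m, n < m → (verma k (B c s ^ n)) v m = 0 := by
    intro n
    induction n with
    | zero =>
      refine ⟨by simp [hv], fun m hm => ?_⟩
      simp [hv, (Nat.pos_iff_ne_zero.mp hm)]
    | succ n ih =>
      have h := verma_B_apply c s _ n ih.2
      rw [pow_succ', map_mul]
      exact ⟨h.1.trans ih.1, h.2⟩
  rw [injective_iff_map_eq_zero]
  intro p hp
  have h := congrArg (fun x => verma k x v p.natDegree) hp
  simp only [map_zero, LinearMap.zero_apply, Pi.zero_apply] at h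
  rw [Polynomial.aeval_eq_sum_range, map_sum, LinearMap.sum_apply, Finset.sum_apply,
    Finset.sum_eq_single p.natDegree] at h
  · rw [map_smul, LinearMap.smul_apply, Pi.smul_apply, (key _).1, smul_eq_mul, mul_one] at h
    exact Polynomial.leadingCoeff_eq_zero.mp h
  · intro i hi hne
    have : i < p.natDegree := by
      have := Finset.mem_range.mp hi
      omega
    rw [map_smul, LinearMap.smul_apply, Pi.smul_apply, (key i).2 _ this, smul_zero]
  · intro h
    simp at h

/-- `B_{c,s}` is the polynomial algebra in `B₁`. -/
def BcsEquiv (c s : RatFunc k) : Polynomial (RatFunc k) ≃ₐ[RatFunc k] Bcs c s :=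
  (AlgEquiv.ofInjective _ (aeval_B_injective c s)).trans
    (Subalgebra.equivOfEq _ _ (Bcs_eq_range c s).symm)

lemma BcsEquiv_X (c s : RatFunc k) : BcsEquiv c s Polynomial.X = ⟨B c s, B_mem c s⟩ := by
  apply Subtype.ext
  simp [BcsEquiv]

/-- The bar involution of `B_{c,s}`: the `k`-algebra automorphism with `q ↦ q⁻¹` and `B₁ ↦ B₁`.
It is determined by these two properties, see `barB_unique`. -/
def barB (c s : RatFunc k) : Bcs c s ≃+* Bcs c s :=
  ((BcsEquiv c s).symm.toRingEquiv.trans (Polynomial.mapEquiv (bar k).toRingEquiv)).trans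
    (BcsEquiv c s).toRingEquiv

lemma barB_B (c s : RatFunc k) : barB c s ⟨B c s, B_mem c s⟩ = ⟨B c s, B_mem c s⟩ := by
  rw [← BcsEquiv_X]
  simp [barB]

lemma barB_algebraMap (c s : RatFunc k) (a : RatFunc k) :
    barB c s (algebraMap _ _ a) = algebraMap (RatFunc k) (Bcs c s) (bar k a) := by
  have h1 : algebraMap (RatFunc k) (Bcs c s) a = BcsEquiv c s (Polynomial.C a) :=
    ((BcsEquiv c s).commutes a).symm
  have h2 : algebraMap (RatFunc k) (Bcs c s) (bar k a) =
      BcsEquiv c s (Polynomial.C (bar k a)) := ((BcsEquiv c s).commutes _).symm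
  rw [h1, h2]
  simp [barB]

lemma barB_unique (c s : RatFunc k) (σ : Bcs c s →+* Bcs c s)
    (hq : ∀ a, σ (algebraMap _ _ a) = algebraMap (RatFunc k) (Bcs c s) (bar k a))
    (hB : σ ⟨B c s, B_mem c s⟩ = ⟨B c s, B_mem c s⟩) (b : Bcs c s) : σ b = barB c s b := by
  obtain ⟨p, rfl⟩ := (BcsEquiv c s).surjective b
  have h : (σ.comp (BcsEquiv c s : Polynomial (RatFunc k) →+* Bcs c s)) =
      ((barB c s : Bcs c s →+* Bcs c s).comp
        (BcsEquiv c s : Polynomial (RatFunc k) →+* Bcs c s)) := by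
    apply Polynomial.ringHom_ext
    · intro a
      have h1 : BcsEquiv c s (Polynomial.C a) = algebraMap (RatFunc k) (Bcs c s) a :=
        (BcsEquiv c s).commutes a
      simp only [RingHom.comp_apply, RingHom.coe_coe]
      rw [h1, hq, barB_algebraMap]
    · simp only [RingHom.comp_apply, RingHom.coe_coe]
      rw [BcsEquiv_X, hB, barB_B]
  exact RingHom.congr_fun h p

/-! ### Parameters and the quasi `K`-matrix -/

/-- The admissible parameters: `c₁ ≠ 0`, `c₁ = q^{(α₁, Θ(α₁) - 2ρ_X)} \bar{c₁}` with `ρ_X = 0`, and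
`\bar{s₁} = s₁`. -/
def IsParameter (c s : RatFunc k) : Prop :=
  c ≠ 0 ∧ c = (q k) ^ form 1 (Theta 1) * bar k c ∧ bar k s = s

/-- `Ξ = ∑_μ Ξ_μ ∈ ∏_μ U⁺_μ` is a quasi `K`-matrix for `B_{c,s}`: `Ξ_0 = 1`, and the identity
`\bar{b}^B Ξ = Ξ \bar{b}^U` holds in `𝒰` for all `b ∈ B_{c,s}`. -/
def IsQuasiKMatrix (c s : RatFunc k) (Ξ : UPlusHat k) : Prop :=
  (Ξ 0 : U k) = 1 ∧ ∀ b : Bcs c s,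
    toCompl k (barB c s b : U k) * hatToCompl Ξ = hatToCompl Ξ * toCompl k (barU k (b : U k))

end Algebra

end AI1

end

/-!
Since `K₁` acts on `U⁺_{mα₁}` by `q^{2m}` and the powers of `E₁` are linearly independent, an
element of `∏ U⁺_{mα₁}` is a formal sum `∑ aₘ E₁ᵐ` (`exists_smul_E_pow_of_mem`).  The claim is that
it is a quasi `K`-matrix exactly when `a₀ = 1`, `a₁ = 0` and
`{m+2} a_{m+2} = (q - q⁻¹) q² c₁ aₘ`; the solution of this recursion, `quasiKCoeff`, is the stated
closed formula (`quasiKCoeff_even`, `quasiKCoeff_odd`).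

Existence.  As `B_{c,0}` is generated by `B₁`, only the relation for `B₁` matters
(`intertwines_of_intertwines_B`).  The commutator `[E₁ⁿ, F₁]` (`E_pow_succ_mul_F`) and
`\bar{c₁} = q² c₁` show that the recursion turns the commutator of `F₁` with the degree `m + 2` part
into the contribution of the degree `m` part to the terms with `E₁ K₁^{±1}`
(`commutator_quasiKCoeff`).  On a given module the formal sum is a finite sum, and summing over `m`
gives the relation.

Uniqueness.  The relation in `𝒰` can be tested on the simple modules of type 1, constructed here
in a basis on which `E₁` is a shift, so that the matrix coefficients of `∑ aₘ E₁ᵐ` are the `aₘ`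
themselves (`hatToCompl_simpleModule_apply`).  Applying both sides of the relation for `B₁` to the
lowest weight vector of the module of highest weight `N` and reading off a single coefficient yields
the recursion for `a_N` (`IsQuasiKMatrix.coeff_relation`).
-/

namespace AI1

universe u

variable {k : Type u} [Field k]

/-! ### `q`-numbers and the coefficients -/

lemma q_zpow_sub_ne_zero {a b : ℤ} (h : a ≠ b) : (q k) ^ a - (q k) ^ b ≠ 0 :=
  fun h0 => h (q_zpow_injective k (sub_eq_zero.mp h0))

lemma q_sq_sub_one_ne_zero : q k ^ 2 - 1 ≠ 0 := by
  simpa using q_zpow_sub_ne_zero (k := k) (a := 2) (b := 0) (by norm_num)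

lemma brace_mul (n : ℕ) : brace k n * (q k ^ 2 - 1) = q k ^ (2 * n) - 1 := by
  have hq := q_ne_zero k
  have hd := q_sq_sub_one_ne_zero (k := k)
  rw [brace, qNum, zpow_sub₀ hq, zpow_neg, zpow_natCast, zpow_one]
  field_simp
  ring

lemma brace_ne_zero {n : ℕ} (hn : n ≠ 0) : brace k n ≠ 0 := by
  intro h
  have h1 := brace_mul (k := k) n
  rw [h, zero_mul] at h1
  refine q_zpow_sub_ne_zero (k := k) (a := 2 * n) (b := 0) (by omega) ?_
  rw [zpow_zero, h1]
  norm_cast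

lemma brace_one : brace k 1 = 1 := by
  refine mul_right_cancel₀ (q_sq_sub_one_ne_zero (k := k)) ?_
  rw [brace_mul]
  ring

lemma brace_succ (n : ℕ) : brace k (n + 1) = brace k n + q k ^ (2 * n) := by
  refine mul_right_cancel₀ (q_sq_sub_one_ne_zero (k := k)) ?_
  rw [add_mul, brace_mul, brace_mul]
  ring

lemma brace_succ' (n : ℕ) : brace k (n + 1) = q k ^ 2 * brace k n + 1 := by
  refine mul_right_cancel₀ (q_sq_sub_one_ne_zero (k := k)) ?_
  rw [add_mul, mul_assoc, brace_mul, brace_mul]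
  ring

/-- The coefficient of `E₁ᵐ` in the quasi `K`-matrix, defined by the two-step recursion to which
the intertwining relation is equivalent. -/
noncomputable def quasiKCoeff (c : RatFunc k) : ℕ → RatFunc k
  | 0 => 1
  | 1 => 0
  | m + 2 => (q k - (q k)⁻¹) * (q k ^ 2 * c) / brace k (m + 2) * quasiKCoeff c m

lemma brace_mul_quasiKCoeff (c : RatFunc k) (m : ℕ) :
    brace k (m + 2) * quasiKCoeff c (m + 2) =
      (q k - (q k)⁻¹) * (q k ^ 2 * c) * quasiKCoeff c m := by
  have := brace_ne_zero (k := k) (n := m + 2) (by omega)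
  rw [quasiKCoeff]
  field_simp

lemma quasiKCoeff_odd (c : RatFunc k) (n : ℕ) : quasiKCoeff c (2 * n + 1) = 0 := by
  induction n with
  | zero => rfl
  | succ n ih => rw [show 2 * (n + 1) + 1 = 2 * n + 1 + 2 by ring, quasiKCoeff, ih, mul_zero]

lemma braceDoubleFactorial_succ (n : ℕ) : braceDoubleFactorial k (2 * (n + 1)) =
    brace k (2 * n + 2) * braceDoubleFactorial k (2 * n) := by
  unfold braceDoubleFactorial
  rw [show (2 * (n + 1) + 1) / 2 = n + 1 by omega, show (2 * n + 1) / 2 = n by omega,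
    Finset.prod_range_succ', mul_comm]
  congr 1
  refine Finset.prod_congr rfl fun j _ => ?_
  congr 1
  omega

lemma quasiKCoeff_even (c : RatFunc k) (n : ℕ) : quasiKCoeff c (2 * n) =
    (q k - (q k)⁻¹) ^ n / braceDoubleFactorial k (2 * n) * (q k ^ 2 * c) ^ n := by
  induction n with
  | zero => simp [quasiKCoeff, braceDoubleFactorial]
  | succ n ih =>
    rw [braceDoubleFactorial_succ, show 2 * (n + 1) = 2 * n + 2 by ring, quasiKCoeff, ih]
    simp only [div_eq_mul_inv, mul_inv, pow_succ _ n]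
    generalize q k - (q k)⁻¹ = d
    ring

/-! ### Commutation relations in `U` -/

lemma K_mul_E_pow (n : ℕ) :
    (K k : U k) * E k ^ n = (q k) ^ (2 * n) • (E k ^ n * (K k : U k)) := by
  have h : (K k : U k) * E k = (q k) ^ 2 • (E k * (K k : U k)) := by
    have := congrArg (· * (K k : U k)) (K_mul_E k)
    simpa [mul_assoc] using this
  induction n with
  | zero => simp
  | succ n ih =>
    rw [pow_succ, ← mul_assoc, ih, smul_mul_assoc, mul_assoc, h, mul_smul_comm, smul_smul,
      ← mul_assoc, ← pow_add]
    rfl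

lemma Kinv_mul_E_pow (n : ℕ) : (((K k)⁻¹ : (U k)ˣ) : U k) * E k ^ n =
    ((q k)⁻¹) ^ (2 * n) • (E k ^ n * (((K k)⁻¹ : (U k)ˣ) : U k)) := by
  have h := congrArg (fun x => (((K k)⁻¹ : (U k)ˣ) : U k) * x * (((K k)⁻¹ : (U k)ˣ) : U k))
    (K_mul_E_pow (k := k) n)
  simp only [mul_assoc, Units.mul_inv, mul_one, Units.inv_mul_cancel_left, mul_smul_comm,
    smul_mul_assoc] at h
  rw [h, smul_smul, mul_comm, q_pow_mul_inv_pow, one_smul]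

/-- `[E₁ⁿ⁺¹, F₁]` in `U`. -/
lemma E_pow_succ_mul_F (n : ℕ) : E k ^ (n + 1) * F k - F k * E k ^ (n + 1) =
    (brace k (n + 1) * (q k - (q k)⁻¹)⁻¹) • (E k ^ n * (K k : U k) -
      ((q k)⁻¹) ^ (2 * n) • (E k ^ n * (((K k)⁻¹ : (U k)ˣ) : U k))) := by
  induction n with
  | zero => simp [E_mul_F, brace_one]
  | succ n ih =>
    have h : E k ^ (n + 1 + 1) * F k - F k * E k ^ (n + 1 + 1) =
        E k * (E k ^ (n + 1) * F k - F k * E k ^ (n + 1)) +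
          (E k * F k - F k * E k) * E k ^ (n + 1) := by
      rw [pow_succ' _ (n + 1)]
      noncomm_ring
    rw [h, ih, E_mul_F, smul_mul_assoc, sub_mul, K_mul_E_pow, Kinv_mul_E_pow, mul_smul_comm,
      mul_sub, mul_smul_comm, ← mul_assoc, ← mul_assoc, ← pow_succ', brace_succ (n + 1)]
    have e1 : brace k (n + 1) * (q k)⁻¹ ^ (2 * n) + (q k)⁻¹ ^ (2 * (n + 1)) =
        (brace k (n + 1) + q k ^ (2 * (n + 1))) * (q k)⁻¹ ^ (2 * (n + 1)) := by
      rw [← brace_succ, brace_succ' (n + 1), show 2 * (n + 1) = 2 * n + 2 by ring, pow_add (q k)⁻¹]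
      have := q_ne_zero k
      field_simp
    simp only [smul_sub, smul_smul]
    rw [sub_add_sub_comm, ← add_smul, ← add_smul]
    congr 2
    · ring
    · linear_combination (q k - (q k)⁻¹)⁻¹ * e1

/-! ### Weight spaces of the positive part -/

/-- In the representation `verma`, the power `E₁ⁿ` is a shift by `n` up to nonzero scalars, away
from the index `0`, where `E₁ f` vanishes. -/
lemma verma_E_pow_apply (n m : ℕ) : ∃ x : RatFunc k, x ≠ 0 ∧
    ∀ f, verma k (E k ^ n) f (m + 1) = x * f (m + 1 + n) := by
  induction n with
  | zero => exact ⟨1, one_ne_zero, fun f => by simp⟩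
  | succ n ih =>
    obtain ⟨x, hx, h⟩ := ih
    have hne : ∀ j : ℕ, q k ^ (j + 1) - (q k)⁻¹ ^ (j + 1) ≠ 0 := by
      intro j
      have := q_zpow_sub_ne_zero (k := k) (a := (j + 1 : ℕ)) (b := -(j + 1 : ℕ)) (by omega)
      rwa [zpow_neg, zpow_natCast, ← inv_pow] at this
    refine ⟨x * (-((q k ^ (m + 1 + n + 1) - (q k)⁻¹ ^ (m + 1 + n + 1)) *
      (q k ^ (m + 1 + n) - (q k)⁻¹ ^ (m + 1 + n))) * ((q k - (q k)⁻¹)⁻¹) ^ 2), ?_, fun f => ?_⟩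
    · refine mul_ne_zero hx (mul_ne_zero (neg_ne_zero.mpr (mul_ne_zero (hne _) ?_))
        (pow_ne_zero _ (inv_ne_zero q_sub_ne_zero)))
      rw [show m + 1 + n = m + n + 1 by ring]
      exact hne _
    · rw [pow_succ, map_mul, Module.End.mul_apply, h]
      simp [verma, vermaE, mul_assoc, add_assoc]

/-- `E₁` is transcendental over `k(q)`. -/
lemma aeval_E_injective : Function.Injective (Polynomial.aeval (R := RatFunc k) (E k)) := by
  rw [injective_iff_map_eq_zero]
  intro p hp
  ext j
  have h := congrArg (fun x => verma k x (Pi.single (0 + 1 + j) 1) (0 + 1)) hp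
  obtain ⟨x, hx, hxf⟩ := verma_E_pow_apply (k := k) j 0
  rw [Polynomial.aeval_eq_sum_range' (n := p.natDegree + j + 1) (by omega)] at h
  simp only [map_sum, LinearMap.sum_apply, Finset.sum_apply, map_zero, LinearMap.zero_apply,
    Pi.zero_apply] at h
  rw [Finset.sum_eq_single j] at h
  · rw [map_smul, LinearMap.smul_apply, Pi.smul_apply, hxf] at h
    simpa [hx] using h
  · intro i _ hij
    obtain ⟨y, -, hy⟩ := verma_E_pow_apply (k := k) i 0
    rw [map_smul, LinearMap.smul_apply, Pi.smul_apply, hy, Pi.single_eq_of_ne (by omega)]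
    simp
  · intro hj
    simp at hj

/-- `U⁺_{m α₁}` is spanned by `E₁ᵐ`. -/
lemma exists_smul_E_pow_of_mem {m : ℕ} {u : U k} (hu : u ∈ UPlusWt k m) :
    ∃ a : RatFunc k, u = a • E k ^ m := by
  obtain ⟨h1, h2⟩ := hu
  rw [UPlus, Algebra.adjoin_singleton_eq_range_aeval] at h1
  obtain ⟨p, rfl⟩ := h1
  -- Conjugation by `K₁` rescales the argument of a polynomial in `E₁` by `q²`.
  have hconj : ∀ r : Polynomial (RatFunc k),
      (K k : U k) * Polynomial.aeval (E k) r * (((K k)⁻¹ : (U k)ˣ) : U k) =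
        Polynomial.aeval (E k) (r.comp (Polynomial.C (q k ^ 2) * Polynomial.X)) := by
    intro r
    induction r using Polynomial.induction_on' with
    | add r s hr hs => simp only [map_add, mul_add, add_mul, hr, hs, Polynomial.add_comp]
    | monomial n a =>
      rw [← Polynomial.C_mul_X_pow_eq_monomial]
      simp only [map_mul, Polynomial.aeval_C, map_pow, Polynomial.aeval_X, Polynomial.mul_comp,
        Polynomial.C_comp, Polynomial.pow_comp, Polynomial.X_comp, ← Algebra.smul_def,
        mul_smul_comm, smul_mul_assoc, K_mul_E_pow, mul_assoc, Units.mul_inv, mul_one]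
      simp only [← map_pow, ← Algebra.smul_def, smul_pow, ← pow_mul]
  change (K k : U k) * Polynomial.aeval (E k) p * _ = _ • Polynomial.aeval (E k) p at h2
  change ∃ a : RatFunc k, Polynomial.aeval (E k) p = _
  rw [hconj, ← map_smul] at h2
  have h3 := aeval_E_injective h2
  refine ⟨p.coeff m, ?_⟩
  have hp : p = Polynomial.monomial m (p.coeff m) := by
    ext j
    have hj := congrArg (fun r => Polynomial.coeff r j) h3
    simp only [Polynomial.comp_C_mul_X_coeff, Polynomial.coeff_smul, smul_eq_mul] at hj
    rw [Polynomial.coeff_monomial]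
    split_ifs with hmj
    · rw [hmj]
    · refine (mul_eq_zero.mp (?_ : p.coeff j *
        (q k ^ (2 * (j : ℤ)) - q k ^ form m 1) = 0)).resolve_right
          (q_zpow_sub_ne_zero (by unfold form; omega))
      rw [mul_sub, sub_eq_zero, mul_comm _ (q k ^ form m 1), ← hj, ← pow_mul]
      norm_cast
  conv_lhs => rw [hp]
  rw [Polynomial.aeval_monomial, Algebra.smul_def]

lemma E_pow_mem_UPlusWt (m : ℕ) : E k ^ m ∈ UPlusWt k m := by
  refine ⟨pow_mem (Algebra.self_mem_adjoin_singleton _ _) m, ?_⟩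
  rw [K_mul_E_pow, smul_mul_assoc, mul_assoc, Units.mul_inv, mul_one]
  congr 1
  rw [← zpow_natCast]
  simp [form]

/-! ### Existence -/

/-- The formal sum `∑ aₘ E₁ᵐ` with coefficients `quasiKCoeff`. -/
noncomputable def quasiK (c : RatFunc k) : UPlusHat k :=
  fun m => ⟨quasiKCoeff c m • E k ^ m, Submodule.smul_mem _ _ (E_pow_mem_UPlusWt m)⟩

lemma barU_smul (a : RatFunc k) (x : U k) : barU k (a • x) = bar k a • barU k x := by
  rw [Algebra.smul_def, map_mul, barU_algebraMap, ← Algebra.smul_def]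

lemma barU_B (c : RatFunc k) : barU k (B c 0) = F k - bar k c • (E k * (K k : U k)) := by
  have hK : barU k (((K k)⁻¹ : (U k)ˣ) : U k) = (K k : U k) := barUHom_Kinv k
  simp [B, barU_smul, barU_F, barU_E, hK]

lemma IsParameter.bar_eq {c : RatFunc k} (hc : IsParameter c 0) : bar k c = q k ^ 2 * c := by
  have h := hc.2.1
  rw [show form 1 (Theta 1) = -2 from rfl] at h
  nth_rw 2 [h]
  rw [← mul_assoc, ← zpow_natCast, ← zpow_add₀ (q_ne_zero k)]
  simp

/-- The homogeneous part of degree `m + 1` of the intertwining relation for `B₁`: by the recursion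
for the coefficients, the terms with `F₁` in degree `m + 2` cancel those with `E₁` in degree `m`. -/
lemma commutator_quasiKCoeff {c : RatFunc k} (hc : bar k c = q k ^ 2 * c) (m : ℕ) :
    F k * (quasiKCoeff c (m + 2) • E k ^ (m + 2)) - (quasiKCoeff c (m + 2) • E k ^ (m + 2)) * F k =
      c • (E k * (((K k)⁻¹ : (U k)ˣ) : U k)) * (quasiKCoeff c m • E k ^ m) -
        (quasiKCoeff c m • E k ^ m) * (bar k c • (E k * (K k : U k))) := by
  have h := E_pow_succ_mul_F (k := k) (m + 1)
  have hr := brace_mul_quasiKCoeff c m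
  have hd : q k - (q k)⁻¹ ≠ 0 := q_sub_ne_zero
  have hq := q_ne_zero k
  rw [mul_smul_comm, smul_mul_assoc, ← smul_sub, ← neg_sub, h]
  simp only [smul_mul_assoc, mul_smul_comm]
  rw [mul_assoc (E k), Kinv_mul_E_pow, mul_smul_comm, ← mul_assoc, ← mul_assoc, ← pow_succ',
    ← pow_succ, hc]
  have e : quasiKCoeff c (m + 2) * (brace k (m + 2) * (q k - (q k)⁻¹)⁻¹) =
      q k ^ 2 * c * quasiKCoeff c m := by
    rw [← mul_assoc, mul_comm _ (brace k (m + 2)), hr]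
    linear_combination q k ^ 2 * c * quasiKCoeff c m * mul_inv_cancel₀ hd
  have e2 : (q k)⁻¹ ^ (2 * (m + 1)) * q k ^ 2 = (q k)⁻¹ ^ (2 * m) := by
    rw [show 2 * (m + 1) = 2 * m + 2 by ring, pow_add (q k)⁻¹]
    field_simp
  rw [smul_neg, smul_smul, e, smul_sub, smul_smul, smul_smul, smul_smul, smul_smul, neg_sub,
    mul_comm (q k ^ 2 * c) (quasiKCoeff c m)]
  congr 2
  linear_combination c * quasiKCoeff c m * e2

/-- The intertwining relation only has to be checked for the generator `B₁`. -/
lemma intertwines_of_intertwines_B {c s : RatFunc k} {Ξ : UCompl k}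
    (h : toCompl k (B c s) * Ξ = Ξ * toCompl k (barU k (B c s))) (b : Bcs c s) :
    toCompl k (barB c s b : U k) * Ξ = Ξ * toCompl k (barU k (b : U k)) := by
  obtain ⟨p, rfl⟩ := (BcsEquiv c s).surjective b
  induction p using Polynomial.induction_on with
  | C a =>
    have : BcsEquiv c s (Polynomial.C a) = algebraMap (RatFunc k) (Bcs c s) a :=
      (BcsEquiv c s).commutes a
    rw [this, barB_algebraMap]
    simp only [Subalgebra.coe_algebraMap, barU_algebraMap, AlgHom.commutes]
    exact Algebra.commutes _ _
  | add p r hp hr => simp only [map_add, Subalgebra.coe_add, add_mul, mul_add, hp, hr]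
  | monomial n a ih =>
    rw [pow_succ, ← mul_assoc, map_mul (BcsEquiv c s) _ Polynomial.X, map_mul (barB c s),
      BcsEquiv_X, barB_B, Subalgebra.coe_mul, Subalgebra.coe_mul, map_mul (toCompl k),
      map_mul (barU k), map_mul (toCompl k), mul_assoc, h, ← mul_assoc, ih, mul_assoc]

/-- On a given module, an element of the completion of `U⁺` acts by any of its sufficiently long
partial sums. -/
lemma exists_hatToCompl_eq_sum (Ξ : UPlusHat k) (V : OInt k) :
    ∃ M : ℕ, ∀ j, M ≤ j →
      (hatToCompl Ξ).1 V = V.ρ (∑ m ∈ Finset.range j, (Ξ m : U k)) := by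
  obtain ⟨N, hN⟩ := (finite_support_act Ξ V).bddAbove
  refine ⟨N + 1, fun j hj => ?_⟩
  rw [map_sum]
  refine finsum_eq_sum_of_support_subset _ fun m hm => ?_
  rw [Finset.coe_range, Set.mem_Iio]
  have := hN hm
  omega

lemma isQuasiKMatrix_quasiK {c : RatFunc k} (hc : IsParameter c 0) :
    IsQuasiKMatrix c 0 (quasiK c) := by
  refine ⟨by simp [quasiK, quasiKCoeff], intertwines_of_intertwines_B ?_⟩
  apply Subtype.ext
  funext V
  obtain ⟨M, hsum⟩ := exists_hatToCompl_eq_sum (quasiK c) V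
  change V.ρ (B c 0) * (hatToCompl (quasiK c) : UCompl k).1 V =
    (hatToCompl (quasiK c) : UCompl k).1 V * V.ρ (barU k (B c 0))
  rw [barU_B, B, zero_smul, add_zero]
  simp only [map_sub, sub_mul, mul_sub]
  -- The sum is truncated two degrees later in the terms with `F₁`, which lowers the degree, than
  -- in those with `E₁`, which raises it.
  rw [sub_eq_sub_iff_sub_eq_sub]
  nth_rw 1 2 [hsum (M + 2) (by omega)]
  rw [hsum M le_rfl]
  simp only [← map_mul, ← map_sub]
  congr 1
  simp only [Finset.mul_sum, Finset.sum_mul, ← Finset.sum_sub_distrib]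
  rw [Finset.sum_range_succ', Finset.sum_range_succ']
  simp only [quasiK, zero_add]
  rw [Finset.sum_congr rfl fun m _ => commutator_quasiKCoeff hc.bar_eq m]
  simp [quasiKCoeff]

/-! ### The simple modules of type 1 -/

lemma qNum_zero : qNum k 0 = 0 := by simp [qNum]

/-- The identity behind `E₁F₁ - F₁E₁ = (K₁ - K₁⁻¹) / (q - q⁻¹)` on the simple modules. -/
lemma qNum_identity (a b : ℤ) :
    qNum k (a + 1) * qNum k b - qNum k a * qNum k (b + 1) =
      (q k - (q k)⁻¹)⁻¹ * (q k ^ (b - a) - q k ^ (-(b - a))) := by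
  have hq := q_ne_zero k
  have hd := q_sq_sub_one_ne_zero (k := k)
  have ha := zpow_ne_zero a hq
  have hb := zpow_ne_zero b hq
  simp only [qNum, zpow_add₀ hq, zpow_sub₀ hq, zpow_neg, zpow_one]
  generalize q k ^ a = x at *
  generalize q k ^ b = y at *
  field_simp
  ring

/-- Action of `E₁` in `simpleModule N`, as a shift. -/
noncomputable def simpleE (N : ℕ) : Module.End (RatFunc k) (Fin (N + 1) → RatFunc k) where
  toFun f i := if h : (i : ℕ) + 1 < N + 1 then f ⟨i + 1, h⟩ else 0
  map_add' f g := by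
    funext i
    simp only [Pi.add_apply]
    split_ifs <;> simp only [add_zero]
  map_smul' a f := by
    funext i
    simp only [Pi.smul_apply, smul_eq_mul, RingHom.id_apply]
    split_ifs <;> simp only [mul_zero]

/-- Action of `F₁` in `simpleModule N`.  At `i = 0` the truncated index `i - 1` is harmless,
because `[0] = 0`. -/
noncomputable def simpleF (N : ℕ) : Module.End (RatFunc k) (Fin (N + 1) → RatFunc k) where
  toFun f i := qNum k i * qNum k (N - i + 1) * f ⟨i - 1, by omega⟩
  map_add' f g := by
    funext i
    simp only [Pi.add_apply]
    ring
  map_smul' a f := by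
    funext i
    simp only [Pi.smul_apply, smul_eq_mul, RingHom.id_apply]
    ring

/-- Action of `K₁` (for `x = q`) and of `K₁⁻¹` (for `x = q⁻¹`) in `simpleModule N`. -/
noncomputable def simpleK (N : ℕ) (x : RatFunc k) :
    Module.End (RatFunc k) (Fin (N + 1) → RatFunc k) where
  toFun f i := x ^ ((N : ℤ) - 2 * i) * f i
  map_add' f g := by
    funext i
    simp only [Pi.add_apply]
    ring
  map_smul' a f := by
    funext i
    simp only [Pi.smul_apply, smul_eq_mul, RingHom.id_apply]
    ring

variable (k) in
/-- The representation of `U` on the simple module of highest weight `N`, written on coordinate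
vectors with respect to a basis `v₀, …, v_N` in which `v_i` has weight `N - 2i`,
`E₁ v_i = v_{i-1}` and `F₁ v_i = [i+1][N-i] v_{i+1}`. -/
noncomputable def simpleRep (N : ℕ) :
    U k →ₐ[RatFunc k] Module.End (RatFunc k) (Fin (N + 1) → RatFunc k) :=
  liftU (simpleE N) (simpleF N) (simpleK N (q k)) (simpleK N (q k)⁻¹)
    (by
      refine LinearMap.ext fun f => funext fun i => ?_
      simp only [simpleK, Module.End.mul_apply, Module.End.one_apply, LinearMap.coe_mk,
        AddHom.coe_mk, inv_zpow]
      field_simp [zpow_ne_zero _ (q_ne_zero k)])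
    (by
      refine LinearMap.ext fun f => funext fun i => ?_
      simp only [simpleK, Module.End.mul_apply, Module.End.one_apply, LinearMap.coe_mk,
        AddHom.coe_mk, inv_zpow]
      field_simp [zpow_ne_zero _ (q_ne_zero k)])
    (by
      refine LinearMap.ext fun f => funext fun i => ?_
      have hq := q_ne_zero k
      by_cases h : (i : ℕ) + 1 < N + 1
      · simp only [Module.End.mul_apply, simpleK, simpleE, LinearMap.coe_mk, AddHom.coe_mk, h,
          dif_pos, LinearMap.smul_apply, Pi.smul_apply, smul_eq_mul, inv_zpow', ← mul_assoc,
          ← zpow_add₀ hq]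
        congr 2
        push_cast
        ring
      · simp only [Module.End.mul_apply, simpleK, simpleE, LinearMap.coe_mk, AddHom.coe_mk, h,
          LinearMap.smul_apply, Pi.smul_apply, dif_neg, not_false_eq_true, mul_zero, smul_zero])
    (by
      refine LinearMap.ext fun f => funext fun i => ?_
      have hq := q_ne_zero k
      simp only [Module.End.mul_apply, simpleK, simpleF, LinearMap.coe_mk, AddHom.coe_mk,
        LinearMap.smul_apply, Pi.smul_apply, smul_eq_mul]
      rcases Nat.eq_zero_or_pos (i : ℕ) with h0 | h0
      · simp [h0, qNum_zero]
      · have e : q k ^ ((N : ℤ) - 2 * (i : ℕ)) *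
            (q k)⁻¹ ^ ((N : ℤ) - 2 * ((i : ℕ) - 1 : ℕ)) = q k ^ (-2 : ℤ) := by
          rw [inv_zpow', ← zpow_add₀ hq]
          congr 1
          omega
        linear_combination qNum k i * qNum k (N - i + 1) * f ⟨i - 1, by omega⟩ * e)
    (by
      refine LinearMap.ext fun f => funext fun i => ?_
      have h := qNum_identity (k := k) i (N - i)
      simp only [Module.End.mul_apply, simpleK, simpleF, simpleE, LinearMap.coe_mk, AddHom.coe_mk,
        LinearMap.smul_apply, LinearMap.sub_apply, Pi.sub_apply, Pi.smul_apply, smul_eq_mul]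
      have e1 : (if hi : (i : ℕ) + 1 < N + 1 then
          qNum k ((i + 1 : ℕ) : ℤ) * qNum k (N - ((i + 1 : ℕ) : ℤ) + 1) *
            f ⟨(i : ℕ) + 1 - 1, by omega⟩ else 0) = qNum k (i + 1) * qNum k (N - i) * f i := by
        split_ifs with hi
        · rw [show (N : ℤ) - ((i + 1 : ℕ) : ℤ) + 1 = N - i by push_cast; ring]
          rfl
        · rw [show (N : ℤ) - (i : ℕ) = 0 by omega, qNum_zero]
          simp
      have e2 : qNum k i * qNum k (N - i + 1) * (if hi : (i : ℕ) - 1 + 1 < N + 1 then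
          f ⟨(i : ℕ) - 1 + 1, hi⟩ else 0) = qNum k i * qNum k (N - i + 1) * f i := by
        rcases Nat.eq_zero_or_pos (i : ℕ) with h0 | h0
        · simp [h0, qNum_zero]
        · rw [dif_pos (by omega)]
          congr 2
          ext
          exact Nat.sub_add_cancel h0
      rw [e1, e2, inv_zpow', ← sub_mul, ← sub_mul, h, show (N : ℤ) - i - i = N - 2 * i by ring]
      ring)

variable (k) in
/-- The simple module of highest weight `N` and type 1. -/
noncomputable def simpleModule (N : ℕ) : OInt k where
  carrier := Fin (N + 1) → RatFunc k
  ρ := simpleRep k N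
  type_one := by
    rw [eq_top_iff]
    intro f _
    rw [← Finset.univ_sum_single f]
    refine Submodule.sum_mem _ fun i _ => Submodule.mem_iSup_of_mem ((N : ℤ) - 2 * i) ?_
    rw [Module.End.mem_eigenspace_iff]
    funext j
    simp only [simpleRep, liftU_K, simpleK, LinearMap.coe_mk, AddHom.coe_mk, Pi.smul_apply,
      smul_eq_mul]
    rcases eq_or_ne j i with rfl | h
    · rfl
    · simp [h]

lemma simpleRep_E_pow_apply (N n : ℕ) (f : Fin (N + 1) → RatFunc k) (i : Fin (N + 1)) :
    simpleRep k N (E k ^ n) f i =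
      if h : (i : ℕ) + n < N + 1 then f ⟨i + n, h⟩ else 0 := by
  induction n generalizing i with
  | zero => simp [i.isLt]
  | succ n ih =>
    rw [pow_succ', map_mul, Module.End.mul_apply]
    simp only [simpleRep, liftU_E] at ih ⊢
    simp only [simpleE, LinearMap.coe_mk, AddHom.coe_mk] at ih ⊢
    by_cases h : (i : ℕ) + 1 < N + 1
    · rw [dif_pos h, ih]
      simp only [add_assoc, add_comm 1 n]
    · rw [dif_neg h, dif_neg (by omega)]

/-! ### Uniqueness -/

/-- The matrix coefficients of `∑ aₘ E₁ᵐ` on a simple module. -/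
lemma hatToCompl_simpleModule_apply {Ξ : UPlusHat k} {a : ℕ → RatFunc k}
    (ha : ∀ m, (Ξ m : U k) = a m • E k ^ m) (N : ℕ) (i j : Fin (N + 1)) :
    ((hatToCompl Ξ).1 (simpleModule k N) : Module.End (RatFunc k) (Fin (N + 1) → RatFunc k))
      (Pi.single j 1) i = if i ≤ j then a (j - i) else 0 := by
  obtain ⟨M, hM⟩ := exists_hatToCompl_eq_sum Ξ (simpleModule k N)
  rw [hM (max M (N + 1)) (le_max_left _ _)]
  change simpleRep k N _ (Pi.single j 1) i = _
  simp only [ha, map_sum, map_smul, LinearMap.sum_apply, Finset.sum_apply, LinearMap.smul_apply,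
    Pi.smul_apply, simpleRep_E_pow_apply, smul_eq_mul]
  have hterm : ∀ m, a m * (if h : (i : ℕ) + m < N + 1 then
      (Pi.single j 1 : Fin (N + 1) → RatFunc k) ⟨i + m, h⟩ else 0) =
        if (i : ℕ) + m = j then a m else 0 := by
    intro m
    rcases eq_or_ne ((i : ℕ) + m) j with h | h
    · have hj : (⟨i + m, by omega⟩ : Fin (N + 1)) = j := Fin.ext h
      rw [dif_pos (by omega), hj, Pi.single_eq_same, if_pos h, mul_one]
    · rw [if_neg h]
      split_ifs with h'
      · rw [Pi.single_eq_of_ne (fun h0 => h (congrArg Fin.val h0)), mul_zero]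
      · rw [mul_zero]
  simp only [hterm]
  split_ifs with hij
  · have hij' : (i : ℕ) ≤ j := hij
    rw [Finset.sum_eq_single ((j : ℕ) - i)]
    · rw [if_pos (by omega)]
    · intro m _ hm
      rw [if_neg (by omega)]
    · intro hm
      have := j.isLt
      exact absurd (Finset.mem_range.mpr (lt_max_of_lt_right (by omega))) hm
  · have hij' : ¬ (i : ℕ) ≤ j := hij
    exact Finset.sum_eq_zero fun m _ => if_neg (by omega)

/-- Comparing, on the simple module of highest weight `N = n + 1`, the coefficients of `v₁` in the
two sides of the intertwining relation for `B₁` applied to the lowest weight vector `v_N`.  The two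
terms on the right come from `E₁ K₁⁻¹` and `E₁ K₁`; they are absent for `N = 1`, because
`∑ aₘ E₁ᵐ` involves no negative powers. -/
lemma IsQuasiKMatrix.coeff_relation {c : RatFunc k} {Ξ : UPlusHat k} (h : IsQuasiKMatrix c 0 Ξ)
    {a : ℕ → RatFunc k} (ha : ∀ m, (Ξ m : U k) = a m • E k ^ m) (n : ℕ) :
    qNum k (n + 1) * a (n + 1) =
      if 1 ≤ n then (c * q k ^ (3 - (n : ℤ)) - bar k c * q k ^ (-(n + 1) : ℤ)) * a (n - 1)
      else 0 := by
  let X : Module.End (RatFunc k) (Fin (n + 1 + 1) → RatFunc k) :=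
    (hatToCompl Ξ).1 (simpleModule k (n + 1))
  have hcoef : ∀ i j, X (Pi.single j 1) i = if i ≤ j then a (j - i) else 0 :=
    hatToCompl_simpleModule_apply ha (n + 1)
  have hB := h.2 ⟨B c 0, B_mem c 0⟩
  rw [barB_B, barU_B] at hB
  have hrel : simpleRep k (n + 1) (B c 0) * X =
      X * simpleRep k (n + 1) (F k - bar k c • (E k * (K k : U k))) :=
    congrFun (congrArg Subtype.val hB) (simpleModule k (n + 1))
  clear_value X
  have hF : simpleF (n + 1) (Pi.single (Fin.last (n + 1)) 1) =
      (0 : Fin (n + 1 + 1) → RatFunc k) := by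
    funext i
    have : (⟨(i : ℕ) - 1, by omega⟩ : Fin (n + 1 + 1)) ≠ Fin.last (n + 1) := by
      intro h0
      have := congrArg Fin.val h0
      simp only [Fin.val_last] at this
      omega
    simp [simpleF, Pi.single_eq_of_ne this]
  have hEK : simpleE (n + 1) (simpleK (n + 1) (q k) (Pi.single (Fin.last (n + 1)) 1)) =
      q k ^ (-(n + 1) : ℤ) • (Pi.single ⟨n, by omega⟩ 1 : Fin (n + 1 + 1) → RatFunc k) := by
    funext i
    simp only [simpleE, simpleK, LinearMap.coe_mk, AddHom.coe_mk, Pi.smul_apply, smul_eq_mul]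
    rcases eq_or_ne (i : ℕ) n with h0 | h0
    · have h1 : i = ⟨n, by omega⟩ := Fin.ext h0
      have h2 : (⟨n + 1, by omega⟩ : Fin (n + 1 + 1)) = Fin.last (n + 1) := rfl
      rw [h1, dif_pos (by simp), h2, Pi.single_eq_same, Pi.single_eq_same]
      congr 2
      push_cast
      ring
    · rw [Pi.single_eq_of_ne (fun h1 => h0 (congrArg Fin.val h1)), mul_zero]
      split_ifs with h1
      · rw [Pi.single_eq_of_ne, mul_zero]
        intro h2
        have := congrArg Fin.val h2
        simp only [Fin.val_last] at this
        omega
      · rfl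
  have h1 := congrFun (LinearMap.congr_fun hrel (Pi.single (Fin.last (n + 1)) 1)) ⟨1, by omega⟩
  have hq1 : qNum k 1 = 1 := by simpa [brace] using brace_one (k := k)
  simp only [simpleRep, B, zero_smul, add_zero, map_sub, map_smul, map_mul, liftU_F, liftU_E,
    liftU_K, liftU_Kinv, Module.End.mul_apply, LinearMap.sub_apply, LinearMap.smul_apply, hF, hEK,
    map_neg, zero_sub, Pi.sub_apply, Pi.neg_apply, Pi.smul_apply, smul_eq_mul] at h1
  simp only [simpleF, simpleE, simpleK, LinearMap.coe_mk, AddHom.coe_mk, hcoef] at h1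
  rw [if_pos (Fin.le_last _), Nat.cast_one, hq1, one_mul,
    show (((n + 1 : ℕ) : ℤ) - 1 + 1) = n + 1 by push_cast; ring] at h1
  simp only [Fin.val_last, Nat.sub_self, Nat.sub_zero, Fin.mk_le_mk] at h1
  by_cases hn : 1 ≤ n
  · rw [dif_pos (by omega), if_pos (Fin.le_last _), if_pos hn, inv_zpow',
      show n + 1 - (1 + 1) = n - 1 by omega,
      show -(((n + 1 : ℕ) : ℤ) - 2 * ((1 + 1 : ℕ) : ℤ)) = 3 - n by push_cast; ring] at h1
    rw [if_pos hn]
    linear_combination h1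
  · rw [dif_neg (by omega), if_neg hn] at h1
    rw [if_neg hn]
    linear_combination h1

lemma quasiK_unique {c : RatFunc k} (hc : IsParameter c 0) {Ξ : UPlusHat k}
    (h : IsQuasiKMatrix c 0 Ξ) : Ξ = quasiK c := by
  choose a ha using fun m => exists_smul_E_pow_of_mem (Ξ m).2
  have hrec := h.coeff_relation ha
  have hbrace : ∀ n : ℕ, brace k (n + 1) = q k ^ n * qNum k (n + 1) := by
    intro n
    simp [brace]
  have hmain : ∀ m, a m = quasiKCoeff c m := by
    intro m
    induction m using Nat.twoStepInduction with
    | zero =>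
      have h0 := h.1
      rw [ha, pow_zero] at h0
      have : Polynomial.C (a 0) = 1 := by
        apply aeval_E_injective
        rw [Polynomial.aeval_C, map_one, Algebra.algebraMap_eq_smul_one, h0]
      rw [← Polynomial.C_1] at this
      exact Polynomial.C_injective this
    | one =>
      have h1 := hrec 0
      have hq1 : qNum k 1 = 1 := by simpa [brace] using brace_one (k := k)
      simpa [hq1, quasiKCoeff] using h1
    | more m ih _ =>
      have h2 := hrec (m + 1)
      refine mul_left_cancel₀ (brace_ne_zero (k := k) (n := m + 2) (by omega)) ?_
      rw [brace_mul_quasiKCoeff, ← ih, hbrace, mul_assoc, h2, if_pos (by omega), hc.bar_eq]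
      have hq := q_ne_zero k
      have e1 : q k ^ (m + 1) * q k ^ (3 - ((m + 1 : ℕ) : ℤ)) = q k ^ 3 := by
        rw [← zpow_natCast, ← zpow_natCast, ← zpow_add₀ hq]
        congr 1
        push_cast
        ring
      have e2 : q k ^ (m + 1) * q k ^ (-(((m + 1 : ℕ) : ℤ) + 1)) = (q k)⁻¹ := by
        rw [← zpow_natCast, ← zpow_neg_one, ← zpow_add₀ hq]
        congr 1
        push_cast
        ring
      rw [Nat.add_sub_cancel]
      linear_combination c * a m * e1 - q k ^ 2 * c * a m * e2
  funext m
  exact Subtype.ext (by rw [ha, hmain]; rfl)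

end AI1

theorem mainTheorem7 {k : Type*} [Field k] [CharZero k] (c : RatFunc k)
    (hc : AI1.IsParameter c 0) :
    (∃! Ξ : AI1.UPlusHat k, AI1.IsQuasiKMatrix c 0 Ξ) ∧
    ∀ Ξ : AI1.UPlusHat k, AI1.IsQuasiKMatrix c 0 Ξ →
      (∀ n : ℕ, (Ξ (2 * n) : AI1.U k) =
        ((AI1.q k - (AI1.q k)⁻¹) ^ n / AI1.braceDoubleFactorial k (2 * n) *
          (AI1.q k ^ 2 * c) ^ n) • AI1.E k ^ (2 * n)) ∧
      (∀ n : ℕ, (Ξ (2 * n + 1) : AI1.U k) = 0) := by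
  refine ⟨⟨AI1.quasiK c, AI1.isQuasiKMatrix_quasiK hc, fun Ξ h => AI1.quasiK_unique hc h⟩, ?_⟩
  intro Ξ h
  obtain rfl := AI1.quasiK_unique hc h
  refine ⟨fun n => ?_, fun n => ?_⟩
  · rw [← AI1.quasiKCoeff_even]
    rfl
  · simp [AI1.quasiK, AI1.quasiKCoeff_odd]
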